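/- **Proposition.** Let $p\ge 1$, $a_\pi>0$, $b>0$, and let $\beta=(\beta_1,\dots,\beta_p)$ have the R2-D2 prior with double-exponential kernel, in its Gamma representation and with error variance $\sigma^2=1$: $$\xi\sim\mathrm{Ga}(b,1),\qquad \lambda_j\mid\xi\sim\mathrm{Ga}(a_\pi,\xi),\qquad \beta_j\mid\lambda_j\sim\mathrm{DE}\big((\lambda_j/2)^{1/2}\big),\qquad j=1,\dots,p,$$ where the $\lambda_j$ are independent given $\xi$, the $\beta_j$ are independent given $(\lambda_1,\dots,\lambda_p)$ with $\beta_j$ depending on $\xi$ and the $\lambda$'s only through $\lambda_j$, $\mathrm{Ga}(\mu,\nu)$ is the Gamma distribution with shape $\mu$ and rate $\nu$, and $\mathrm{DE}(\delta)$ is the double-exponential distribution with density $x\mapsto\frac1{2\delta}e^{-|x|/\delta}$ on $\mathbb R$. Then for every $j=1,\dots,p$ the marginal distribution of $\beta_j$ has a density $\pi_{\mathrm{R2\text{-}D2}}$ with respect to Lebesgue measure on $\mathbb R$ such that, for every real $x\neq 0$, $$\pi_{\mathrm{R2\text{-}D2}}(x)=\frac{1}{(2\pi)^{1/2}\,\Gamma(a_\pi)\Gamma(b)}\;G^{3,1}_{1,3}\!\left(\frac{x^2}{2}\,\middle|\,\begin{matrix}\tfrac12-b\\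 a_\pi-\tfrac12,\,0,\,\tfrac12\end{matrix}\right)=\frac{1}{(2\pi)^{1/2}\,\Gamma(a_\pi)\Gamma(b)}\;G^{1,3}_{3,1}\!\left(\frac{2}{x^2}\,\middle|\,\begin{matrix}\tfrac32-a_\pi,\,1,\,\tfrac12\\ \tfrac12+b\end{matrix}\right).$$ Here $G^{m,n}_{p,q}$ is the Meijer $G$-function $$G^{m,n}_{p,q}\!\left(z\,\middle|\,\begin{matrix}a_1,\dots,a_p\\ b_1,\dots,b_q\end{matrix}\right)=\frac1{2\pi i}\int_L\frac{\prod_{k=1}^m\Gamma(b_k-s)\,\prod_{k=1}^n\Gamma(1-a_k+s)}{\prod_{k=m+1}^q\Gamma(1-b_k+s)\,\prod_{k=n+1}^p\Gamma(a_k-s)}\,z^s\,ds,$$ where $L$ is a vertical line, directed upwards, having the poles of the $\Gamma(b_k-s)$, $k\le m$, on its right and those of the $\Gamma(1-a_k+s)$, $k\le n$, on its left. For both functions above such a line exists, and along every such line the integral converges absolutely and has the same value. -/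

import Mathlib

open MeasureTheory ProbabilityTheory Set

/-! ### The Meijer G-function -/

/-- The quotient of Gamma functions in the definition of `G^{m,n}_{p,q}`:
`∏_{j ≤ m} Γ(b_j - s) ∏_{i ≤ n} Γ(1 - a_i + s) /`
`(∏_{j > m} Γ(1 - b_j + s) ∏_{i > n} Γ(a_i - s))`.
Indices start at `0` here, so that `j ≤ m` reads `j < m`. (Mathlib's `Complex.Gamma` is `0` at its
poles, hence the reciprocal in the denominator is the entire function `1 / Γ` everywhere.) -/
noncomputable def meijerKernel (m n : ℕ) {p q : ℕ} (a : Fin p → ℂ) (b : Fin q → ℂ) (s : ℂ) : ℂ :=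
  ((∏ j : Fin q, if (j : ℕ) < m then Complex.Gamma (b j - s) else 1) *
      ∏ i : Fin p, if (i : ℕ) < n then Complex.Gamma (1 - a i + s) else 1) /
    ((∏ j : Fin q, if (j : ℕ) < m then 1 else Complex.Gamma (1 - b j + s)) *
      ∏ i : Fin p, if (i : ℕ) < n then 1 else Complex.Gamma (a i - s))

/-- The vertical line `Re s = c` has all the poles `b_j + k` of `Γ(b_j - s)`, `j ≤ m`, on its right
and all the poles `a_i - 1 - k` of `Γ(1 - a_i + s)`, `i ≤ n`, on its left (`k = 0, 1, 2, …`). -/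
def MeijerLineSeparates (m n : ℕ) {p q : ℕ} (a : Fin p → ℂ) (b : Fin q → ℂ) (c : ℝ) : Prop :=
  (∀ j : Fin q, (j : ℕ) < m → ∀ k : ℕ, c < (b j + k).re) ∧
    ∀ i : Fin p, (i : ℕ) < n → ∀ k : ℕ, (a i - 1 - k).re < c

/-- `w` is the value at `z` of the Meijer G-function `G^{m,n}_{p,q}` with upper parameters `a` and
lower parameters `b`, as a convergent Mellin–Barnes integral over a vertical line:
`w = (1 / 2πi) ∫_{c - i∞}^{c + i∞} meijerKernel(s) z^s ds`.
A line that separates the two families of poles exists, and along each such line the integral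
converges absolutely and has the value `w`. -/
def HasMeijerG (m n : ℕ) {p q : ℕ} (a : Fin p → ℂ) (b : Fin q → ℂ) (z w : ℂ) : Prop :=
  (∃ c : ℝ, MeijerLineSeparates m n a b c) ∧
    ∀ c : ℝ, MeijerLineSeparates m n a b c →
      Integrable (fun t : ℝ ↦ meijerKernel m n a b (c + t * Complex.I) *
        z ^ ((c : ℂ) + t * Complex.I)) ∧
      w = 1 / (2 * Real.pi * Complex.I) *
        ∫ t : ℝ, meijerKernel m n a b (c + t * Complex.I) *
          z ^ ((c : ℂ) + t * Complex.I) * Complex.I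

open Classical in
/-- The Meijer G-function `G^{m,n}_{p,q}(z | a; b)`, for parameters whose poles are separated by a
vertical line along which the Mellin–Barnes integral converges (and `0` otherwise). -/
noncomputable def meijerG (m n : ℕ) {p q : ℕ} (a : Fin p → ℂ) (b : Fin q → ℂ) (z : ℂ) : ℂ :=
  if h : ∃ w, HasMeijerG m n a b z w then h.choose else 0

/-- The value is unique, so that `meijerG` is that value whenever there is one. -/
theorem HasMeijerG.meijerG_eq {m n p q : ℕ} {a : Fin p → ℂ} {b : Fin q → ℂ} {z w : ℂ}
    (h : HasMeijerG m n a b z w) : meijerG m n a b z = w := by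
  have hex : ∃ w, HasMeijerG m n a b z w := ⟨w, h⟩
  rw [meijerG, dif_pos hex]
  obtain ⟨c, hc⟩ := h.1
  rw [(hex.choose_spec.2 c hc).2, (h.2 c hc).2]

/-! ### The double-exponential distribution -/

/-- The density of `DE(δ)`, the double-exponential distribution with mean `0` and variance
`2 δ ^ 2`, where `δ > 0`. -/
noncomputable def doubleExpPDF (δ x : ℝ) : ℝ := 1 / (2 * δ) * Real.exp (-|x| / δ)

/-- The law `DE(δ)`; the point mass at `0` when `δ ≤ 0`. -/
noncomputable def doubleExpMeasure (δ : ℝ) : Measure ℝ :=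
  if 0 < δ then volume.withDensity (fun x ↦ ENNReal.ofReal (doubleExpPDF δ x))
  else Measure.dirac 0

theorem integral_doubleExpPDF {δ : ℝ} (hδ : 0 < δ) : ∫ x, doubleExpPDF δ x = 1 := by
  unfold doubleExpPDF
  rw [integral_const_mul, integral_comp_abs (f := fun x : ℝ ↦ Real.exp (-x / δ))]
  have : ∫ x in Ioi (0 : ℝ), Real.exp (-x / δ) = δ := by
    have h := integral_exp_mul_Ioi (a := -δ⁻¹) (by simpa using hδ) 0
    simp only [mul_zero, Real.exp_zero] at h
    calc ∫ x in Ioi (0 : ℝ), Real.exp (-x / δ) = ∫ x in Ioi (0 : ℝ), Real.exp (-δ⁻¹ * x) := by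
          congr 1; ext x; congr 1; field_simp
      _ = δ := by rw [h]; field_simp
  rw [this]
  field_simp

theorem integrable_doubleExpPDF {δ : ℝ} (hδ : 0 < δ) : Integrable (doubleExpPDF δ) := by
  by_contra h
  have h1 := integral_doubleExpPDF hδ
  rw [integral_undef h] at h1
  exact zero_ne_one h1

instance isProbabilityMeasure_doubleExpMeasure (δ : ℝ) :
    IsProbabilityMeasure (doubleExpMeasure δ) := by
  unfold doubleExpMeasure
  split_ifs with hδ
  · constructor
    rw [withDensity_apply _ MeasurableSet.univ, Measure.restrict_univ,
      ← ofReal_integral_eq_lintegral_ofReal (integrable_doubleExpPDF hδ)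
        (Filter.Eventually.of_forall fun x ↦ by unfold doubleExpPDF; positivity),
      integral_doubleExpPDF hδ, ENNReal.ofReal_one]
  · infer_instance

theorem measurable_doubleExpMeasure : Measurable doubleExpMeasure := by
  unfold doubleExpMeasure
  refine Measurable.ite measurableSet_Ioi ?_ measurable_const
  refine measurable_withDensity ?_
  unfold doubleExpPDF Function.uncurry
  fun_prop

/-- The Markov kernel `δ ↦ DE(δ)`. -/
noncomputable def doubleExpKernel : Kernel ℝ ℝ := ⟨doubleExpMeasure, measurable_doubleExpMeasure⟩

instance isMarkovKernel_doubleExpKernel : IsMarkovKernel doubleExpKernel :=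
  ⟨fun δ ↦ isProbabilityMeasure_doubleExpMeasure δ⟩

/-! ### The Gamma distribution as a kernel in its rate -/

/-- The law `Ga(a, ξ)` with shape `a` and rate `ξ`; the point mass at `0` when `a ≤ 0` or
`ξ ≤ 0`. -/
noncomputable def gammaLaw (a ξ : ℝ) : Measure ℝ :=
  if 0 < a ∧ 0 < ξ then gammaMeasure a ξ else Measure.dirac 0

instance isProbabilityMeasure_gammaLaw (a ξ : ℝ) : IsProbabilityMeasure (gammaLaw a ξ) := by
  unfold gammaLaw
  split_ifs with h
  · exact isProbabilityMeasure_gammaMeasure h.1 h.2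
  · infer_instance

theorem measurable_gammaLaw (a : ℝ) : Measurable (gammaLaw a) := by
  unfold gammaLaw
  refine Measurable.ite ((MeasurableSet.const (0 < a)).inter measurableSet_Ioi) ?_ measurable_const
  unfold gammaMeasure
  refine measurable_withDensity ?_
  unfold gammaPDF gammaPDFReal Function.uncurry
  refine ENNReal.measurable_ofReal.comp (Measurable.ite ?_ (by fun_prop) measurable_const)
  exact measurableSet_le measurable_const measurable_snd

/-- The Markov kernel `ξ ↦ Ga(a, ξ)`. -/
noncomputable def gammaKernel (a : ℝ) : Kernel ℝ ℝ := ⟨gammaLaw a, measurable_gammaLaw a⟩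

instance isMarkovKernel_gammaKernel (a : ℝ) : IsMarkovKernel (gammaKernel a) :=
  ⟨fun ξ ↦ isProbabilityMeasure_gammaLaw a ξ⟩

/-! ### The prior -/

/-- The kernel `x ↦ ⨂_j κ_j(x)`: given `x`, the coordinates are independent, and the `j`-th one has
the law `κ_j(x)`. -/
noncomputable def independentKernel {α : Type*} [MeasurableSpace α] {p : ℕ}
    (κ : Fin p → Kernel α ℝ) [∀ j, IsMarkovKernel (κ j)] : Kernel α (Fin p → ℝ) where
  toFun x := Measure.pi fun j ↦ κ j x
  measurable' := by
    refine Measurable.measure_of_isPiSystem_of_isProbabilityMeasure generateFrom_pi.symm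
      isPiSystem_pi ?_
    rintro _ ⟨s, hs, rfl⟩
    simp_rw [Measure.pi_pi]
    exact Finset.measurable_prod _ fun j _ ↦ (κ j).measurable_coe (hs j (mem_univ j))

/-- The R2-D2 prior with double-exponential kernel on `β = (β_1, …, β_p)`, in its Gamma
representation: `ξ ∼ Ga(b, 1)`; given `ξ`, the `λ_j ∼ Ga(aπ, ξ)` are independent; given the
`λ_j`, the `β_j ∼ DE(σ (λ_j / 2)^{1/2})` are independent. -/
noncomputable def r2d2Prior (p : ℕ) (σ aπ b : ℝ) : Measure (Fin p → ℝ) :=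
  ((gammaMeasure b 1).bind (independentKernel fun _ : Fin p ↦ gammaKernel aπ)).bind
    (independentKernel fun j : Fin p ↦
      doubleExpKernel.comap (fun l : Fin p → ℝ ↦ σ * Real.sqrt (l j / 2)) (by fun_prop))

/-! Up to the factor `(√2 Γ(a) Γ(b))⁻¹`, the marginal density at `x` is the integral over `ξ, λ > 0`
of `ξ^(a+b-1) e^(-ξ) λ^(a-3/2) e^(-ξλ) e^(-y)`, where `y = |x| √(2/λ)`. Mellin inversion writes
`e^(-y)` as an integral of `Γ(-2s) y^(2s)` over a line `Re s = c < 0`, and `y^(2s) = (2x²)^s λ^(-s)`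
is a pure power of `λ`. After exchanging the integrals, the one over `(ξ, λ)` is `Γ(a-1/2-s)
Γ(1/2+b+s)`, and Legendre duplication splits `Γ(-2s)` into `Γ(-s) Γ(1/2-s)`: this is the kernel of
`G^{3,1}_{1,3}` at `x²/2`. The substitution `s ↦ -s` gives the second form.

The conditions on `c` for absolute convergence, `-1/2-b < c < min(a-1/2, 0)`, are exactly those for
the line to separate the poles, so every separating line is covered. The exchange is
`integrable_mellinBarnesIntegrand`; the link with the prior is Tonelli, in
`r2d2Prior_map_eq_withDensity`. -/

/-! ### Gamma on vertical lines and Mellin inversion of the exponential -/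

theorem Complex.norm_Gamma_le_Gamma_re {s : ℂ} (hs : 0 < s.re) :
    ‖Complex.Gamma s‖ ≤ Real.Gamma s.re := by
  rw [Complex.Gamma_eq_integral hs, Real.Gamma_eq_integral hs, Complex.GammaIntegral]
  refine (norm_integral_le_integral_norm _).trans_eq ?_
  refine setIntegral_congr_fun measurableSet_Ioi fun t (ht : 0 < t) ↦ ?_
  simp only [norm_mul, Complex.norm_cpow_eq_rpow_re_of_pos ht, Complex.norm_real,
    Real.norm_eq_abs, Real.abs_exp, Complex.sub_re, Complex.one_re]

theorem continuous_Gamma_comp {X : Type*} [TopologicalSpace X] {g : X → ℂ} (hg : Continuous g)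
    (h : ∀ t, 0 < (g t).re) : Continuous fun t ↦ Complex.Gamma (g t) := by
  refine continuous_iff_continuousAt.2 fun t ↦ ContinuousAt.comp (g := Complex.Gamma) ?_
    hg.continuousAt
  refine (Complex.differentiableAt_Gamma _ fun m hm ↦ ?_).continuousAt
  have := h t
  rw [hm] at this
  simp only [Complex.neg_re, Complex.natCast_re, Left.neg_pos_iff] at this
  exact absurd this (not_lt.2 (Nat.cast_nonneg m))

/-- Quadratic decay suffices: `Γ(s+2) = (s+1) s Γ(s)` is bounded on the line by `Γ(σ+2)`, and `|s+1|
≥ |s|`. -/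
theorem integrable_Gamma_vertical {σ : ℝ} (hσ : 0 < σ) :
    Integrable fun t : ℝ ↦ Complex.Gamma (σ + t * Complex.I) := by
  -- The majorant is `Γ(σ+2) / (σ² + t²)`, written as a rescaling of `1 / (1 + t²)`.
  have hbound : Integrable fun t : ℝ ↦ Real.Gamma (σ + 2) / σ ^ 2 * (1 + (σ⁻¹ * t) ^ 2)⁻¹ :=
    (integrable_inv_one_add_sq.comp_mul_left' (inv_ne_zero hσ.ne')).const_mul _
  refine hbound.mono' (continuous_Gamma_comp (by fun_prop)
    fun t ↦ by simpa using hσ).aestronglyMeasurable (.of_forall fun t ↦ ?_)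
  set s : ℂ := σ + t * Complex.I with hs
  have hre : s.re = σ := by simp [hs]
  have him : s.im = t := by simp [hs]
  have h0 : s ≠ 0 := fun h ↦ by rw [h] at hre; simp at hre; linarith
  have h1 : s + 1 ≠ 0 := fun h ↦ by
    have := congrArg Complex.re h
    simp [hre] at this; linarith
  have hrec : Complex.Gamma (s + 2) = (s + 1) * s * Complex.Gamma s := by
    rw [show s + 2 = s + 1 + 1 by ring, Complex.Gamma_add_one _ h1, Complex.Gamma_add_one _ h0]
    ring
  have hle : ‖Complex.Gamma (s + 2)‖ ≤ Real.Gamma (σ + 2) := by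
    have := Complex.norm_Gamma_le_Gamma_re (s := s + 2) (by simp [hre]; linarith)
    simpa [hre] using this
  have hsq : ‖s‖ ^ 2 = σ ^ 2 + t ^ 2 := by
    rw [Complex.sq_norm, Complex.normSq_apply, hre, him]; ring
  have hsq1 : ‖s‖ ≤ ‖s + 1‖ := by
    refine le_of_sq_le_sq ?_ (norm_nonneg _)
    rw [Complex.sq_norm, Complex.sq_norm, Complex.normSq_apply, Complex.normSq_apply]
    simp only [Complex.add_re, Complex.one_re, Complex.add_im, Complex.one_im, hre]
    nlinarith
  rw [hrec, norm_mul, norm_mul] at hle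
  have hkey : (σ ^ 2 + t ^ 2) * ‖Complex.Gamma s‖ ≤ Real.Gamma (σ + 2) := by
    refine le_trans ?_ hle
    rw [← hsq, pow_two]
    gcongr
  have heq : Real.Gamma (σ + 2) / σ ^ 2 * (1 + (σ⁻¹ * t) ^ 2)⁻¹ =
      Real.Gamma (σ + 2) / (σ ^ 2 + t ^ 2) := by
    field_simp
  rw [heq, le_div_iff₀ (by positivity), mul_comm]
  exact hkey

theorem integral_cpow_mul_Gamma_vertical {σ y : ℝ} (hσ : 0 < σ) (hy : 0 < y) :
    ∫ t : ℝ, (y : ℂ) ^ (-(σ + t * Complex.I)) * Complex.Gamma (σ + t * Complex.I) =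
      2 * Real.pi * Real.exp (-y) := by
  have hGamma : ∀ s : ℂ, 0 < s.re → mellin (fun x ↦ (Real.exp (-x) : ℂ)) s = Complex.Gamma s :=
    fun s hs ↦ by rw [Complex.Gamma_eq_integral hs, Complex.GammaIntegral_eq_mellin]
  have hline : ∀ t : ℝ, mellin (fun x ↦ (Real.exp (-x) : ℂ)) (σ + t * Complex.I) =
      Complex.Gamma (σ + t * Complex.I) := fun t ↦ hGamma _ (by simpa using hσ)
  have hconv : MellinConvergent (fun x ↦ (Real.exp (-x) : ℂ)) σ := by
    refine (Complex.GammaIntegral_convergent (s := σ) (by simpa using hσ)).congr_fun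
      (fun t _ ↦ ?_) measurableSet_Ioi
    simp only [smul_eq_mul]; ring
  have hvert : Complex.VerticalIntegrable (mellin fun x ↦ (Real.exp (-x) : ℂ)) σ := by
    refine (integrable_Gamma_vertical hσ).congr (.of_forall fun t ↦ ?_)
    exact (hline t).symm
  have h := mellinInv_mellin_eq σ _ hy hconv hvert (by fun_prop)
  simp only [mellinInv, hline, smul_eq_mul, Complex.real_smul] at h
  rw [← h]
  push_cast
  rw [← mul_assoc, mul_one_div_cancel (by simp [Real.pi_ne_zero]), one_mul]

/-! ### A double integral for a product of two Gamma values -/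

/-- Lebesgue measure on the quadrant `(0, ∞) × (0, ∞)`. -/
noncomputable def quadrantMeasure : Measure (ℝ × ℝ) :=
  (volume.restrict (Ioi 0)).prod (volume.restrict (Ioi 0))

instance sFinite_quadrantMeasure : SFinite quadrantMeasure := by
  unfold quadrantMeasure; infer_instance

theorem ae_pos_quadrantMeasure : ∀ᵐ p ∂quadrantMeasure, 0 < p.1 ∧ 0 < p.2 := by
  rw [quadrantMeasure, Measure.prod_restrict, ae_restrict_iff'
    (measurableSet_Ioi.prod measurableSet_Ioi)]
  exact .of_forall fun p hp ↦ hp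

theorem integrableOn_rpow_mul_exp_neg_mul {u r : ℝ} (hu : 0 < u) (hr : 0 < r) :
    IntegrableOn (fun t : ℝ ↦ t ^ (u - 1) * Real.exp (-(r * t))) (Ioi 0) := by
  have h := integrableOn_rpow_mul_exp_neg_mul_rpow (p := 1) (s := u - 1) (b := r) (by linarith)
    one_pos hr
  simpa only [Real.rpow_one, neg_mul] using h

/-- The integrand of the double integral that represents `Γ(u) Γ(v)`. -/
noncomputable def gammaPairIntegrand (u v : ℂ) (p : ℝ × ℝ) : ℂ :=
  (p.1 : ℂ) ^ (u + v - 1) * Complex.exp (-p.1) *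
    ((p.2 : ℂ) ^ (u - 1) * Complex.exp (-(p.1 * p.2)))

theorem measurable_gammaPairIntegrand (u v : ℂ) : Measurable (gammaPairIntegrand u v) := by
  unfold gammaPairIntegrand; fun_prop

theorem norm_gammaPairIntegrand (u v : ℂ) {p : ℝ × ℝ} (h1 : 0 < p.1) (h2 : 0 < p.2) :
    ‖gammaPairIntegrand u v p‖ = p.1 ^ (u.re + v.re - 1) * Real.exp (-p.1) *
      (p.2 ^ (u.re - 1) * Real.exp (-(p.1 * p.2))) := by
  simp [gammaPairIntegrand, Complex.norm_cpow_eq_rpow_re_of_pos h1,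
    Complex.norm_cpow_eq_rpow_re_of_pos h2, Complex.norm_exp]

theorem integrable_gammaPairIntegrand {u v : ℂ} (hu : 0 < u.re) (hv : 0 < v.re) :
    Integrable (gammaPairIntegrand u v) quadrantMeasure := by
  rw [quadrantMeasure, integrable_prod_iff
    (measurable_gammaPairIntegrand u v).aestronglyMeasurable]
  constructor
  · refine (ae_restrict_mem measurableSet_Ioi).mono fun x (hx : 0 < x) ↦ ?_
    refine ((integrableOn_rpow_mul_exp_neg_mul hu hx).const_mul
      (x ^ (u.re + v.re - 1) * Real.exp (-x))).mono'
      ((measurable_gammaPairIntegrand u v).comp measurable_prodMk_left).aestronglyMeasurable ?_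
    refine (ae_restrict_mem measurableSet_Ioi).mono fun y (hy : 0 < y) ↦ ?_
    exact (norm_gammaPairIntegrand u v (p := (x, y)) hx hy).le
  · refine ((integrableOn_rpow_mul_exp_neg_mul hv one_pos).const_mul (Real.Gamma u.re)).congr ?_
    refine (ae_restrict_mem measurableSet_Ioi).mono fun x (hx : 0 < x) ↦ ?_
    have : ∫ y in Ioi (0 : ℝ), ‖gammaPairIntegrand u v (x, y)‖ =
        ∫ y in Ioi (0 : ℝ), x ^ (u.re + v.re - 1) * Real.exp (-x) *
          (y ^ (u.re - 1) * Real.exp (-(x * y))) :=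
      setIntegral_congr_fun measurableSet_Ioi fun y (hy : 0 < y) ↦
        norm_gammaPairIntegrand u v (p := (x, y)) hx hy
    simp only [this, integral_const_mul]
    rw [Real.integral_rpow_mul_exp_neg_mul_Ioi hu hx, one_div, Real.inv_rpow hx.le,
      show u.re + v.re - 1 = u.re + (v.re - 1) by ring, Real.rpow_add hx, one_mul]
    field_simp

/-- Integrating out `p.2` gives `Γ(u) p.1^(-u)`, which leaves Euler's integral for `Γ(v)` in `p.1`.
-/
theorem integral_gammaPairIntegrand {u v : ℂ} (hu : 0 < u.re) (hv : 0 < v.re) :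
    ∫ p, gammaPairIntegrand u v p ∂quadrantMeasure = Complex.Gamma u * Complex.Gamma v := by
  have hint := integrable_gammaPairIntegrand hu hv
  rw [quadrantMeasure] at hint ⊢
  rw [integral_prod _ hint]
  have hinner : ∀ x ∈ Ioi (0 : ℝ), ∫ y in Ioi (0 : ℝ), gammaPairIntegrand u v (x, y) =
      Complex.Gamma u * ((x : ℂ) ^ (v - 1) * Complex.exp (-((1 : ℝ) * x))) := by
    intro x hx
    have hx0 : (x : ℂ) ≠ 0 := Complex.ofReal_ne_zero.2 (ne_of_gt hx)
    simp only [gammaPairIntegrand, integral_const_mul]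
    rw [Complex.integral_cpow_mul_exp_neg_mul_Ioi hu hx, one_div, Complex.inv_cpow _ _ (by
        rw [Complex.arg_ofReal_of_nonneg (le_of_lt hx)]; exact Real.pi_pos.ne),
      show u + v - 1 = u + (v - 1) by ring, Complex.cpow_add _ _ hx0]
    have : (x : ℂ) ^ u ≠ 0 := by simp [Complex.cpow_eq_zero_iff, hx0]
    field_simp
    simp [mul_right_comm]
  rw [setIntegral_congr_fun measurableSet_Ioi hinner, integral_const_mul,
    Complex.integral_cpow_mul_exp_neg_mul_Ioi hv one_pos]
  simp

/-! ### The joint weight as a Mellin-Barnes integral, and Fubini -/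

/-- The scaled joint density of `(ξ, λ, β)` at `(p.1, p.2, x)`, where `ξ ∼ Ga(b, 1)`,
`λ ∼ Ga(a, ξ)` and `β ∼ DE((λ / 2)^{1/2})`. -/
noncomputable def r2d2JointWeight (a b x : ℝ) (p : ℝ × ℝ) : ℝ :=
  p.1 ^ (a + b - 1) * Real.exp (-p.1) * (p.2 ^ (a - 1 / 2 - 1) * Real.exp (-(p.1 * p.2))) *
    Real.exp (-(|x| * Real.sqrt (2 / p.2)))

theorem measurable_r2d2JointWeight (a b : ℝ) :
    Measurable fun q : ℝ × (ℝ × ℝ) ↦ r2d2JointWeight a b q.1 q.2 := by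
  unfold r2d2JointWeight
  fun_prop

/-- The joint integrand in the quadrant variables and on the Mellin-Barnes line. -/
noncomputable def mellinBarnesIntegrand (a b c x : ℝ) (p : ℝ × ℝ) (t : ℝ) : ℂ :=
  gammaPairIntegrand (a - 1 / 2 - (c + t * Complex.I)) (1 / 2 + b + (c + t * Complex.I)) p *
    (Complex.Gamma (-2 * (c + t * Complex.I)) * ((2 * x ^ 2 : ℝ) : ℂ) ^ (c + t * Complex.I))

/-- Isolates the dependence on `t` as the inversion integrand at `y = |x| √(2/p.2)` and `-2s`. It
rests on `y² = 2x²/p.2`; all bases are positive, so the complex powers multiply. -/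
theorem mellinBarnesIntegrand_eq (a b c : ℝ) {x : ℝ} (hx : x ≠ 0) {p : ℝ × ℝ}
    (h1 : 0 < p.1) (h2 : 0 < p.2) (t : ℝ) :
    mellinBarnesIntegrand a b c x p t =
      ((p.1 ^ (a + b - 1) : ℝ) * Real.exp (-p.1) * ((p.2 ^ (a - 1 / 2 - 1) : ℝ) *
        Real.exp (-(p.1 * p.2))) : ℂ) *
      (((|x| * Real.sqrt (2 / p.2) : ℝ) : ℂ) ^
          (-(((-2 * c : ℝ) : ℂ) + ((-2 * t : ℝ) : ℂ) * Complex.I)) *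
        Complex.Gamma (((-2 * c : ℝ) : ℂ) + ((-2 * t : ℝ) : ℂ) * Complex.I)) := by
  have h20 : (p.2 : ℂ) ≠ 0 := Complex.ofReal_ne_zero.2 h2.ne'
  set s : ℂ := c + t * Complex.I with hs
  have hu : (((-2 * c : ℝ) : ℂ) + ((-2 * t : ℝ) : ℂ) * Complex.I) = -2 * s := by
    rw [hs]; push_cast; ring
  have hy : ((|x| * Real.sqrt (2 / p.2) : ℝ) : ℂ) ^ (2 * s) =
      ((2 * x ^ 2 : ℝ) : ℂ) ^ s * ((p.2 : ℂ) ^ s)⁻¹ := by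
    have hsq : 2 * x ^ 2 * p.2⁻¹ = |x| * Real.sqrt (2 / p.2) * (|x| * Real.sqrt (2 / p.2)) := by
      rw [mul_mul_mul_comm, abs_mul_abs_self, Real.mul_self_sqrt (by positivity)]
      field_simp
    have hpos : 0 < |x| * Real.sqrt (2 / p.2) := by positivity
    rw [← Complex.inv_cpow _ _ (by
        rw [Complex.arg_ofReal_of_nonneg h2.le]; exact Real.pi_pos.ne), ← Complex.ofReal_inv,
      ← Complex.mul_cpow_ofReal_nonneg (by positivity) (by positivity), ← Complex.ofReal_mul, hsq]
    generalize |x| * Real.sqrt (2 / p.2) = y at hpos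
    rw [Complex.ofReal_mul, Complex.mul_cpow_ofReal_nonneg hpos.le hpos.le,
      two_mul, Complex.cpow_add _ _ (Complex.ofReal_ne_zero.2 hpos.ne')]
  rw [hu, neg_mul, neg_neg, hy, mellinBarnesIntegrand, gammaPairIntegrand, ← hs,
    show ((a : ℂ) - 1 / 2 - s) - 1 = ((a - 1 / 2 - 1 : ℝ) : ℂ) - s by push_cast; ring,
    show ((a : ℂ) - 1 / 2 - s) + (1 / 2 + b + s) - 1 = ((a + b - 1 : ℝ) : ℂ) by push_cast; ring,
    Complex.cpow_sub _ _ h20, Complex.ofReal_cpow h1.le, Complex.ofReal_cpow h2.le]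
  push_cast
  ring_nf

theorem integral_mellinBarnesIntegrand_line (a b : ℝ) {c x : ℝ} (hx : x ≠ 0) (hc : c < 0)
    {p : ℝ × ℝ} (h1 : 0 < p.1) (h2 : 0 < p.2) :
    ∫ t : ℝ, mellinBarnesIntegrand a b c x p t = Real.pi * r2d2JointWeight a b x p := by
  simp_rw [mellinBarnesIntegrand_eq a b c hx h1 h2, integral_const_mul]
  -- The Jacobian `1/2` of `t ↦ -2t` turns the `2π` of the inversion formula into `π`.
  rw [Measure.integral_comp_mul_left (a := -2) (g := fun t : ℝ ↦
    ((|x| * Real.sqrt (2 / p.2) : ℝ) : ℂ) ^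
          (-(((-2 * c : ℝ) : ℂ) + (t : ℂ) * Complex.I)) *
        Complex.Gamma (((-2 * c : ℝ) : ℂ) + (t : ℂ) * Complex.I)),
    integral_cpow_mul_Gamma_vertical (by linarith) (by positivity)]
  simp only [r2d2JointWeight, Complex.real_smul]
  rw [abs_of_neg (by norm_num)]
  push_cast
  ring

/-- Norms of powers of positive reals see only real parts, which are constant on the line. The norm
is therefore a function of `p` times a function of `t`, and joint integrability reduces to the two
factors. -/
theorem norm_mellinBarnesIntegrand (a b c : ℝ) {x : ℝ} (hx : x ≠ 0) {p : ℝ × ℝ} (h1 : 0 < p.1)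
    (h2 : 0 < p.2) (t : ℝ) :
    ‖mellinBarnesIntegrand a b c x p t‖ =
      ‖gammaPairIntegrand (a - 1 / 2 - c) (1 / 2 + b + c) p‖ *
        ‖Complex.Gamma (((-2 * c : ℝ) : ℂ) + ((-2 * t : ℝ) : ℂ) * Complex.I) *
          ((2 * x ^ 2 : ℝ) ^ c : ℝ)‖ := by
  rw [mellinBarnesIntegrand, norm_mul, norm_gammaPairIntegrand _ _ h1 h2,
    norm_gammaPairIntegrand _ _ h1 h2, norm_mul, norm_mul,
    Complex.norm_cpow_eq_rpow_re_of_pos (by positivity), Complex.norm_real,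
    Real.norm_of_nonneg (by positivity)]
  have hre : (c + t * Complex.I).re = c := by simp
  have hG : -2 * (c + t * Complex.I) =
      (((-2 * c : ℝ) : ℂ) + ((-2 * t : ℝ) : ℂ) * Complex.I) := by push_cast; ring
  rw [hG, hre, Complex.sub_re _ (c + t * Complex.I), Complex.add_re _ (c + t * Complex.I), hre,
    Complex.sub_re _ (c : ℂ), Complex.add_re _ (c : ℂ), Complex.ofReal_re]

theorem measurable_mellinBarnesIntegrand (a b x : ℝ) {c : ℝ} (hc : c < 0) :
    Measurable fun q : (ℝ × ℝ) × ℝ ↦ mellinBarnesIntegrand a b c x q.1 q.2 := by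
  have hG : Measurable fun t : ℝ ↦ Complex.Gamma (-2 * (c + t * Complex.I)) :=
    (continuous_Gamma_comp (by fun_prop) fun t ↦ by simp; linarith).measurable
  unfold mellinBarnesIntegrand gammaPairIntegrand
  refine Measurable.mul (by fun_prop) ((hG.comp measurable_snd).mul (by fun_prop))

theorem integrable_mellinBarnesIntegrand {a b c x : ℝ} (hx : x ≠ 0) (hc : c < 0)
    (hca : c < a - 1 / 2) (hcb : -1 / 2 - b < c) :
    Integrable (fun q : (ℝ × ℝ) × ℝ ↦ mellinBarnesIntegrand a b c x q.1 q.2)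
      (quadrantMeasure.prod volume) := by
  have h1 : Integrable (fun p ↦ gammaPairIntegrand (a - 1 / 2 - c) (1 / 2 + b + c) p)
      quadrantMeasure := integrable_gammaPairIntegrand (by simp; linarith) (by simp; linarith)
  have h2 : Integrable fun t : ℝ ↦
      Complex.Gamma (((-2 * c : ℝ) : ℂ) + ((-2 * t : ℝ) : ℂ) * Complex.I) *
          ((2 * x ^ 2 : ℝ) ^ c : ℝ) :=
    ((integrable_Gamma_vertical (σ := -2 * c) (by linarith)).comp_mul_left'
      (R := -2) (by norm_num)).mul_const _
  refine (h1.norm.mul_prod h2.norm).mono'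
    (measurable_mellinBarnesIntegrand a b x hc).aestronglyMeasurable ?_
  have hpos : ∀ᵐ q ∂(quadrantMeasure.prod (volume : Measure ℝ)), 0 < q.1.1 ∧ 0 < q.1.2 :=
    Measure.quasiMeasurePreserving_fst.ae ae_pos_quadrantMeasure
  exact hpos.mono fun q hq ↦ (norm_mellinBarnesIntegrand a b c hx hq.1 hq.2 q.2).le

/-- For `a ≤ 1/2` the power of `p.2` is not integrable at `0` without the factor `e^(-|x|
√(2/p.2))`. Fubini for the Mellin-Barnes integrand handles all `a > 0` at once. -/
theorem integrable_r2d2JointWeight {a b x : ℝ} (hx : x ≠ 0) (ha : 0 < a) (hb : 0 < b) :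
    Integrable (r2d2JointWeight a b x) quadrantMeasure := by
  obtain ⟨c, hc1, hc2⟩ : ∃ c, -1 / 2 - b < c ∧ c < min (a - 1 / 2) 0 :=
    exists_between (lt_min (by linarith) (by linarith))
  obtain ⟨hca, hc⟩ := lt_min_iff.1 hc2
  have h := (integrable_mellinBarnesIntegrand (b := b) hx hc hca hc1).integral_prod_left
  have h' : Integrable (fun p ↦ ((Real.pi * r2d2JointWeight a b x p : ℝ) : ℂ))
      quadrantMeasure := by
    refine h.congr (ae_pos_quadrantMeasure.mono fun p hp ↦ ?_)
    simp only [integral_mellinBarnesIntegrand_line a b hx hc hp.1 hp.2]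
    push_cast; rfl
  have h'' := h'.re.const_mul Real.pi⁻¹
  simpa [← mul_assoc, inv_mul_cancel₀ Real.pi_ne_zero] using h''

theorem integral_mellinBarnesIntegrand_quadrant {a b c : ℝ} (x : ℝ)
    (hca : c < a - 1 / 2) (hcb : -1 / 2 - b < c) (t : ℝ) :
    ∫ p, mellinBarnesIntegrand a b c x p t ∂quadrantMeasure =
      Complex.Gamma (a - 1 / 2 - (c + t * Complex.I)) *
        Complex.Gamma (1 / 2 + b + (c + t * Complex.I)) *
      (Complex.Gamma (-2 * (c + t * Complex.I)) *
        ((2 * x ^ 2 : ℝ) : ℂ) ^ (c + t * Complex.I)) := by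
  simp only [mellinBarnesIntegrand, integral_mul_const]
  rw [integral_gammaPairIntegrand (by simp; linarith) (by simp; linarith)]

/-! ### Identification with the Meijer G-functions -/

/-- Duplication gives `Γ(-s) Γ(1/2-s) = 2^(1+2s) √π Γ(-2s)`, and `2^(2s)` is absorbed by `2x² = 4 ·
(x²/2)`. -/
theorem meijerKernel_three_one_mul_cpow (a b : ℝ) {x : ℝ} (hx : x ≠ 0) (s : ℂ) :
    meijerKernel 3 1 ![1 / 2 - (b : ℂ)] ![(a : ℂ) - 1 / 2, 0, 1 / 2] s *
        ((x : ℂ) ^ 2 / 2) ^ s =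
      2 * Real.sqrt Real.pi * (Complex.Gamma (a - 1 / 2 - s) * Complex.Gamma (1 / 2 + b + s) *
        (Complex.Gamma (-2 * s) * ((2 * x ^ 2 : ℝ) : ℂ) ^ s)) := by
  have hdup := Complex.Gamma_mul_Gamma_add_half (-s)
  have hker : meijerKernel 3 1 ![1 / 2 - (b : ℂ)] ![(a : ℂ) - 1 / 2, 0, 1 / 2] s =
      Complex.Gamma (a - 1 / 2 - s) * (Complex.Gamma (-s) * Complex.Gamma (-s + 1 / 2)) *
        Complex.Gamma (1 / 2 + b + s) := by
    simp [meijerKernel, Fin.prod_univ_succ]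
    ring_nf
  have hpow : ((2 * x ^ 2 : ℝ) : ℂ) ^ s = (2 : ℂ) ^ (2 * s) * ((x : ℂ) ^ 2 / 2) ^ s := by
    rw [show (2 * x ^ 2 : ℝ) = 2 * (2 * (x ^ 2 / 2)) by ring, Complex.ofReal_mul,
      Complex.mul_cpow_ofReal_nonneg (by norm_num) (by positivity), Complex.ofReal_mul,
      Complex.mul_cpow_ofReal_nonneg (by norm_num) (by positivity), two_mul s,
      Complex.cpow_add _ _ two_ne_zero, mul_assoc]
    push_cast; rfl
  rw [hker, hdup, hpow, show 1 - 2 * -s = 1 + 2 * s by ring,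
    Complex.cpow_add _ _ two_ne_zero, Complex.cpow_one, show 2 * -s = -2 * s by ring]
  ring

theorem integrable_and_integral_meijerKernel_three_one {a b c x : ℝ} (hx : x ≠ 0) (hc : c < 0)
    (hca : c < a - 1 / 2) (hcb : -1 / 2 - b < c) :
    (Integrable fun t : ℝ ↦
      meijerKernel 3 1 ![1 / 2 - (b : ℂ)] ![(a : ℂ) - 1 / 2, 0, 1 / 2] (c + t * Complex.I) *
        ((x : ℂ) ^ 2 / 2) ^ ((c : ℂ) + t * Complex.I)) ∧
    ∫ t : ℝ,
      meijerKernel 3 1 ![1 / 2 - (b : ℂ)] ![(a : ℂ) - 1 / 2, 0, 1 / 2] (c + t * Complex.I) *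
        ((x : ℂ) ^ 2 / 2) ^ ((c : ℂ) + t * Complex.I) =
      ((2 * Real.sqrt Real.pi * (Real.pi * ∫ p, r2d2JointWeight a b x p ∂quadrantMeasure) : ℝ) :
        ℂ) := by
  have hint := integrable_mellinBarnesIntegrand hx hc hca hcb
  simp_rw [meijerKernel_three_one_mul_cpow a b hx,
    ← integral_mellinBarnesIntegrand_quadrant x hca hcb]
  refine ⟨hint.integral_prod_right.const_mul _, ?_⟩
  rw [integral_const_mul, ← integral_integral_swap hint, integral_congr_ae
    (ae_pos_quadrantMeasure.mono fun p hp ↦ integral_mellinBarnesIntegrand_line a b hx hc hp.1 hp.2),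
    integral_const_mul, integral_complex_ofReal]
  push_cast
  rfl

/-- In each family the pole `k = 0` is the binding one, and `c < 1/2`, from the lower parameter
`1/2`, follows from `c < 0`. -/
theorem meijerLineSeparates_three_one_iff {a b c : ℝ} :
    MeijerLineSeparates 3 1 ![1 / 2 - (b : ℂ)] ![(a : ℂ) - 1 / 2, 0, 1 / 2] c ↔
      c < 0 ∧ c < a - 1 / 2 ∧ -1 / 2 - b < c := by
  simp only [MeijerLineSeparates, Fin.forall_fin_succ]
  simp
  constructor
  · rintro ⟨⟨h1, h2, -⟩, h3⟩
    have := h1 0; have := h2 0; have := h3 0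
    norm_num at *
    exact ⟨by linarith, by linarith, by linarith⟩
  · rintro ⟨h1, h2, h3⟩
    refine ⟨⟨fun k ↦ ?_, fun k ↦ ?_, fun k ↦ ?_⟩, fun k ↦ ?_⟩ <;>
    · have : (0 : ℝ) ≤ k := Nat.cast_nonneg k
      norm_num
      linarith

theorem meijerLineSeparates_one_three_iff {a b c : ℝ} :
    MeijerLineSeparates 1 3 ![3 / 2 - (a : ℂ), 1, 1 / 2] ![1 / 2 + (b : ℂ)] c ↔
      -c < 0 ∧ -c < a - 1 / 2 ∧ -1 / 2 - b < -c := by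
  simp only [MeijerLineSeparates, Fin.forall_fin_succ]
  simp
  constructor
  · rintro ⟨h3, h1, h2, -⟩
    have := h1 0; have := h2 0; have := h3 0
    norm_num at *
    exact ⟨by linarith, by linarith, by linarith⟩
  · rintro ⟨h1, h2, h3⟩
    refine ⟨fun k ↦ ?_, fun k ↦ ?_, fun k ↦ ?_, fun k ↦ ?_⟩ <;>
    · have : (0 : ℝ) ≤ k := Nat.cast_nonneg k
      norm_num
      linarith

theorem meijerKernel_one_three_eq (a b s : ℂ) :
    meijerKernel 1 3 ![3 / 2 - a, 1, 1 / 2] ![1 / 2 + b] s =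
      meijerKernel 3 1 ![1 / 2 - b] ![a - 1 / 2, 0, 1 / 2] (-s) := by
  simp [meijerKernel, Fin.prod_univ_succ]
  ring_nf

theorem two_div_sq_cpow (x : ℝ) (s : ℂ) :
    (2 / (x : ℂ) ^ 2) ^ s = ((x : ℂ) ^ 2 / 2) ^ (-s) := by
  have h : (x : ℂ) ^ 2 / 2 = ((x ^ 2 / 2 : ℝ) : ℂ) := by push_cast; rfl
  rw [← inv_div, h, Complex.inv_cpow _ _ (by
    rw [Complex.arg_ofReal_of_nonneg (by positivity)]; exact Real.pi_pos.ne), Complex.cpow_neg]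

theorem hasMeijerG_three_one {a b x : ℝ} (ha : 0 < a) (hb : 0 < b) (hx : x ≠ 0) :
    HasMeijerG 3 1 ![1 / 2 - (b : ℂ)] ![(a : ℂ) - 1 / 2, 0, 1 / 2] ((x : ℂ) ^ 2 / 2)
      ((Real.sqrt Real.pi * ∫ p, r2d2JointWeight a b x p ∂quadrantMeasure : ℝ) : ℂ) := by
  constructor
  · obtain ⟨c, hc1, hc2⟩ : ∃ c, -1 / 2 - b < c ∧ c < min 0 (a - 1 / 2) :=
      exists_between (lt_min (by linarith) (by linarith))
    exact ⟨c, meijerLineSeparates_three_one_iff.2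
      ⟨(lt_min_iff.1 hc2).1, (lt_min_iff.1 hc2).2, hc1⟩⟩
  · intro c hc
    obtain ⟨h1, h2, h3⟩ := meijerLineSeparates_three_one_iff.1 hc
    obtain ⟨hi, he⟩ := integrable_and_integral_meijerKernel_three_one hx h1 h2 h3
    refine ⟨hi, ?_⟩
    rw [integral_mul_const, he]
    push_cast
    have := Complex.ofReal_ne_zero.2 Real.pi_ne_zero
    have := Complex.I_ne_zero
    field_simp

theorem hasMeijerG_one_three {a b x : ℝ} {w : ℂ}
    (h : HasMeijerG 3 1 ![1 / 2 - (b : ℂ)] ![(a : ℂ) - 1 / 2, 0, 1 / 2] ((x : ℂ) ^ 2 / 2) w) :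
    HasMeijerG 1 3 ![3 / 2 - (a : ℂ), 1, 1 / 2] ![1 / 2 + (b : ℂ)] (2 / (x : ℂ) ^ 2) w := by
  obtain ⟨⟨c, hc⟩, hw⟩ := h
  refine ⟨⟨-c, ?_⟩, fun d hd ↦ ?_⟩
  · rw [meijerLineSeparates_one_three_iff, neg_neg]
    exact meijerLineSeparates_three_one_iff.1 hc
  · obtain ⟨hi, he⟩ := hw (-d) (meijerLineSeparates_three_one_iff.2
      (meijerLineSeparates_one_three_iff.1 hd))
    -- Negation maps the line `Re s = d` to `Re s = -d` with reversed direction; `t ↦ -t` restores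
    -- it.
    have hline : ∀ t : ℝ, -((d : ℂ) + t * Complex.I) =
        ((-d : ℝ) : ℂ) + ((-t : ℝ) : ℂ) * Complex.I := fun t ↦ by push_cast; ring
    simp_rw [meijerKernel_one_three_eq, two_div_sq_cpow, hline]
    refine ⟨hi.comp_neg, ?_⟩
    rw [he, ← integral_neg_eq_self]

/-! ### The marginal law of the prior -/

/-- The density of the marginals of the R2-D2 prior. -/
noncomputable def r2d2Density (a b x : ℝ) : ℝ :=
  (Real.sqrt 2 * Real.Gamma a * Real.Gamma b)⁻¹ * ∫ p, r2d2JointWeight a b x p ∂quadrantMeasure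

theorem measurable_r2d2Density (a b : ℝ) : Measurable (r2d2Density a b) := by
  have := (measurable_r2d2JointWeight a b).stronglyMeasurable.integral_prod_right'
    (ν := quadrantMeasure)
  exact this.measurable.const_mul _

theorem r2d2JointWeight_nonneg_ae (a b x : ℝ) :
    ∀ᵐ p ∂quadrantMeasure, 0 ≤ r2d2JointWeight a b x p :=
  ae_pos_quadrantMeasure.mono fun p ⟨h1, h2⟩ ↦ by unfold r2d2JointWeight; positivity

theorem r2d2Density_nonneg {a b : ℝ} (ha : 0 < a) (hb : 0 < b) (x : ℝ) :
    0 ≤ r2d2Density a b x := by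
  have := Real.Gamma_pos_of_pos ha
  have := Real.Gamma_pos_of_pos hb
  exact mul_nonneg (by positivity) (integral_nonneg_of_ae (r2d2JointWeight_nonneg_ae a b x))

theorem r2d2Density_eq_meijerG {a b x w : ℝ} (hw : (Real.sqrt Real.pi *
    ∫ p, r2d2JointWeight a b x p ∂quadrantMeasure : ℝ) = w) :
    (r2d2Density a b x : ℂ) =
      1 / ((Real.sqrt (2 * Real.pi) * Real.Gamma a * Real.Gamma b : ℝ) : ℂ) * (w : ℂ) := by
  rw [← hw, r2d2Density, Real.sqrt_mul zero_le_two]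
  norm_cast
  have := (Real.sqrt_pos.2 Real.pi_pos).ne'
  simp only [mul_inv, one_div]
  field_simp

theorem gammaMeasure_eq_withDensity_restrict_Ioi (a r : ℝ) :
    gammaMeasure a r = (volume.restrict (Ioi 0)).withDensity fun x ↦
      ENNReal.ofReal (r ^ a / Real.Gamma a * x ^ (a - 1) * Real.exp (-(r * x))) := by
  rw [gammaMeasure, ← withDensity_indicator measurableSet_Ioi]
  refine withDensity_congr_ae ?_
  filter_upwards [compl_mem_ae_iff.2 (measure_singleton (0 : ℝ))] with x hx
  rcases lt_or_gt_of_ne (show x ≠ 0 from hx) with h | h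
  · rw [gammaPDF_of_neg h, indicator_of_notMem (by simpa using h.le)]
  · rw [gammaPDF_of_nonneg h.le, indicator_of_mem (show x ∈ Ioi 0 from h)]

theorem lintegral_gammaMeasure {a r : ℝ} (f : ℝ → ENNReal) (hf : Measurable f) :
    ∫⁻ x, f x ∂(gammaMeasure a r) = ∫⁻ x in Ioi (0 : ℝ),
      ENNReal.ofReal (r ^ a / Real.Gamma a * x ^ (a - 1) * Real.exp (-(r * x))) * f x := by
  rw [gammaMeasure_eq_withDensity_restrict_Ioi, lintegral_withDensity_eq_lintegral_mul _
    (by fun_prop) hf]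
  rfl

theorem independentKernel_map_eval {α : Type*} [MeasurableSpace α] {p : ℕ}
    (κ : Fin p → Kernel α ℝ) [∀ j, IsMarkovKernel (κ j)] (x : α) (j : Fin p) :
    (independentKernel κ x).map (fun β ↦ β j) = κ j x :=
  (measurePreserving_eval (fun j ↦ κ j x) j).map_eq

/-- Each layer is a product of probability measures, so projecting to coordinate `j` discards the
other coordinates, first of `β` and then of `λ`. -/
theorem r2d2Prior_map_apply (p : ℕ) (a b : ℝ) (j : Fin p) {A : Set ℝ} (hA : MeasurableSet A) :
    (r2d2Prior p 1 a b).map (fun β ↦ β j) A =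
      ∫⁻ ξ, ∫⁻ l, doubleExpMeasure (Real.sqrt (l / 2)) A ∂(gammaLaw a ξ)
        ∂(gammaMeasure b 1) := by
  have hmeas : Measurable fun l : ℝ ↦ doubleExpMeasure (Real.sqrt (l / 2)) A :=
    (doubleExpKernel.measurable_coe hA).comp (by fun_prop)
  have hj : Measurable fun β : Fin p → ℝ ↦ β j := measurable_pi_apply j
  rw [Measure.map_apply hj hA, r2d2Prior, Measure.bind_apply (hj hA)
    (Kernel.measurable _).aemeasurable]
  have hinner : ∀ l : Fin p → ℝ, (independentKernel fun j : Fin p ↦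
      doubleExpKernel.comap (fun l : Fin p → ℝ ↦ 1 * Real.sqrt (l j / 2)) (by fun_prop)) l
        ((fun β ↦ β j) ⁻¹' A) = doubleExpMeasure (Real.sqrt (l j / 2)) A := by
    intro l
    rw [← Measure.map_apply hj hA, independentKernel_map_eval, Kernel.comap_apply, one_mul]
    rfl
  simp_rw [hinner]
  rw [Measure.lintegral_bind (f := fun l : Fin p → ℝ ↦ doubleExpMeasure (Real.sqrt (l j / 2)) A)
    (Kernel.measurable _).aemeasurable (hmeas.comp hj).aemeasurable]
  refine lintegral_congr fun ξ ↦ ?_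
  rw [← lintegral_map hmeas hj, independentKernel_map_eval]
  rfl

theorem gamma_mul_doubleExpPDF_eq_r2d2JointWeight {a b x ξ l : ℝ} (hξ : 0 < ξ) (hl : 0 < l) :
    (1 ^ b / Real.Gamma b * ξ ^ (b - 1) * Real.exp (-(1 * ξ))) *
      ((ξ ^ a / Real.Gamma a * l ^ (a - 1) * Real.exp (-(ξ * l))) *
        doubleExpPDF (Real.sqrt (l / 2)) x) =
      (Real.sqrt 2 * Real.Gamma a * Real.Gamma b)⁻¹ * r2d2JointWeight a b x (ξ, l) := by
  have h1 : ξ ^ (a + b - 1) = ξ ^ (b - 1) * ξ ^ a := by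
    rw [← Real.rpow_add hξ]; ring_nf
  have h2 : l ^ (a - 1 / 2 - 1) = l ^ (a - 1) * (Real.sqrt l)⁻¹ := by
    rw [Real.sqrt_eq_rpow, ← Real.rpow_neg hl.le, ← Real.rpow_add hl]; ring_nf
  have h3 : 1 / (2 * Real.sqrt (l / 2)) = (Real.sqrt 2)⁻¹ * (Real.sqrt l)⁻¹ := by
    rw [Real.sqrt_div hl.le]
    have h2 := Real.mul_self_sqrt (zero_le_two (α := ℝ))
    have := Real.sqrt_pos.2 hl
    field_simp
    linarith
  have h4 : -|x| / Real.sqrt (l / 2) = -(|x| * Real.sqrt (2 / l)) := by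
    rw [← inv_div l 2, Real.sqrt_inv, neg_div, div_eq_mul_inv]
  simp only [r2d2JointWeight, doubleExpPDF]
  rw [h1, h2, h3, h4, Real.one_rpow, one_mul]
  simp only [mul_inv]
  ring

theorem r2d2Prior_map_eq_withDensity (p : ℕ) {a b : ℝ} (ha : 0 < a) (hb : 0 < b) (j : Fin p) :
    (r2d2Prior p 1 a b).map (fun β ↦ β j) =
      volume.withDensity fun x ↦ ENNReal.ofReal (r2d2Density a b x) := by
  have hΓa := Real.Gamma_pos_of_pos ha
  have hΓb := Real.Gamma_pos_of_pos hb
  set C := (Real.sqrt 2 * Real.Gamma a * Real.Gamma b)⁻¹ with hC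
  have hw : Measurable fun q : ℝ × (ℝ × ℝ) ↦
      ENNReal.ofReal (C * r2d2JointWeight a b q.1 q.2) :=
    ((measurable_r2d2JointWeight a b).const_mul _).ennreal_ofReal
  ext A hA
  have hmeas : Measurable fun l : ℝ ↦ doubleExpMeasure (Real.sqrt (l / 2)) A :=
    (doubleExpKernel.measurable_coe hA).comp (by fun_prop)
  have hlaw : Measurable fun ξ ↦ ∫⁻ l, doubleExpMeasure (Real.sqrt (l / 2)) A ∂(gammaLaw a ξ) :=
    (Measure.measurable_lintegral hmeas).comp (measurable_gammaLaw a)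
  -- The point `x = 0` must be left out: for `a ≤ 1/2` the weight there is not integrable, so the
  -- Bochner integral is `0` while the Lebesgue integral is infinite. One point is a null set.
  have hdens : ∀ x ≠ 0, ENNReal.ofReal (r2d2Density a b x) =
      ∫⁻ p, ENNReal.ofReal (C * r2d2JointWeight a b x p) ∂quadrantMeasure := by
    intro x hx
    rw [r2d2Density, ← integral_const_mul]
    exact ofReal_integral_eq_lintegral_ofReal ((integrable_r2d2JointWeight hx ha hb).const_mul _)
      ((r2d2JointWeight_nonneg_ae a b x).mono fun p hp ↦ mul_nonneg (by positivity) hp)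
  rw [r2d2Prior_map_apply p a b j hA, withDensity_apply _ hA, lintegral_gammaMeasure _ hlaw]
  calc _ = ∫⁻ ξ in Ioi (0 : ℝ), ∫⁻ l in Ioi (0 : ℝ), ∫⁻ x in A,
        ENNReal.ofReal (C * r2d2JointWeight a b x (ξ, l)) := by
        refine setLIntegral_congr_fun measurableSet_Ioi fun ξ (hξ : 0 < ξ) ↦ ?_
        rw [gammaLaw, if_pos ⟨ha, hξ⟩, lintegral_gammaMeasure _ hmeas,
          ← lintegral_const_mul _ (by fun_prop)]
        refine setLIntegral_congr_fun measurableSet_Ioi fun l (hl : 0 < l) ↦ ?_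
        have hδ : 0 < Real.sqrt (l / 2) := Real.sqrt_pos.2 (by positivity)
        have hpdf : Measurable fun x ↦ ENNReal.ofReal (doubleExpPDF (Real.sqrt (l / 2)) x) := by
          unfold doubleExpPDF; fun_prop
        rw [doubleExpMeasure, if_pos hδ, withDensity_apply _ hA,
          ← lintegral_const_mul _ hpdf, ← lintegral_const_mul _ (hpdf.const_mul _)]
        refine lintegral_congr fun x ↦ ?_
        rw [← gamma_mul_doubleExpPDF_eq_r2d2JointWeight hξ hl]
        generalize doubleExpPDF (Real.sqrt (l / 2)) x = d
        have h1 : 0 ≤ 1 ^ b / Real.Gamma b * ξ ^ (b - 1) * Real.exp (-(1 * ξ)) := by positivity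
        have h2 : 0 ≤ ξ ^ a / Real.Gamma a * l ^ (a - 1) * Real.exp (-(ξ * l)) := by positivity
        rw [ENNReal.ofReal_mul h1, ENNReal.ofReal_mul h2]
    _ = ∫⁻ p, (∫⁻ x in A, ENNReal.ofReal (C * r2d2JointWeight a b x p)) ∂quadrantMeasure := by
        rw [quadrantMeasure, lintegral_prod]
        exact (Measurable.lintegral_prod_right' (hw.comp measurable_swap)).aemeasurable
    _ = ∫⁻ x in A, (∫⁻ p, ENNReal.ofReal (C * r2d2JointWeight a b x p) ∂quadrantMeasure) :=
        lintegral_lintegral_swap (hw.comp measurable_swap).aemeasurable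
    _ = _ := by
        refine lintegral_congr_ae (ae_restrict_of_ae ?_)
        filter_upwards [compl_mem_ae_iff.2 (measure_singleton (0 : ℝ))] with x hx
        exact (hdens x hx).symm

theorem mainTheorem5 (p : ℕ) (aπ b : ℝ) (haπ : 0 < aπ) (hb : 0 < b) (j : Fin p) :
    ∃ f : ℝ → ℝ, Measurable f ∧ (∀ x, 0 ≤ f x) ∧
      (r2d2Prior p 1 aπ b).map (fun β ↦ β j) =
        volume.withDensity (fun x ↦ ENNReal.ofReal (f x)) ∧
      ∀ x : ℝ, x ≠ 0 →
        (∃ w, HasMeijerG 3 1 ![1 / 2 - (b : ℂ)] ![(aπ : ℂ) - 1 / 2, 0, 1 / 2]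
          ((x : ℂ) ^ 2 / 2) w) ∧
        (∃ w, HasMeijerG 1 3 ![3 / 2 - (aπ : ℂ), 1, 1 / 2] ![1 / 2 + (b : ℂ)]
          (2 / (x : ℂ) ^ 2) w) ∧
        (f x : ℂ) = 1 / ((Real.sqrt (2 * Real.pi) * Real.Gamma aπ * Real.Gamma b : ℝ) : ℂ) *
          meijerG 3 1 ![1 / 2 - (b : ℂ)] ![(aπ : ℂ) - 1 / 2, 0, 1 / 2] ((x : ℂ) ^ 2 / 2) ∧
        (f x : ℂ) = 1 / ((Real.sqrt (2 * Real.pi) * Real.Gamma aπ * Real.Gamma b : ℝ) : ℂ) *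
          meijerG 1 3 ![3 / 2 - (aπ : ℂ), 1, 1 / 2] ![1 / 2 + (b : ℂ)] (2 / (x : ℂ) ^ 2) := by
  refine ⟨r2d2Density aπ b, measurable_r2d2Density aπ b, r2d2Density_nonneg haπ hb,
    r2d2Prior_map_eq_withDensity p haπ hb j, fun x hx ↦ ?_⟩
  have h31 := hasMeijerG_three_one haπ hb hx
  have h13 := hasMeijerG_one_three h31
  refine ⟨⟨_, h31⟩, ⟨_, h13⟩, ?_, ?_⟩
  · rw [h31.meijerG_eq]; exact r2d2Density_eq_meijerG rfl
  · rw [h13.meijerG_eq]; exact r2d2Density_eq_meijerG rfl
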